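/- Let $(\Omega,\mathcal A,P)$ be a probability space and $d\in\mathbb N$. For $j=1,\dots,d$ let $H_j$ be a separable real Hilbert space and $L_j=(L_j(t))_{t\ge 0}$ an $H_j$-valued Lévy process with (almost surely) càdlàg paths, such that $L_1,\dots,L_d$ are independent. Let $\Theta=(\Theta_1,\dots,\Theta_d)$ be an $\mathbb R^d$-valued Lévy process with (almost surely) càdlàg paths, independent of $(L_1,\dots,L_d)$, such that every $\Theta_j$ is a subordinator, i.e. has almost surely nondecreasing paths. Put $L(t)=(L_1(t),\dots,L_d(t))$ and $X(t)=(L_1(\Theta_1(t)),\dots,L_d(\Theta_d(t)))$ for $t\ge 0$; both take values in the Hilbert direct sum $H$ of $H_1,\dots,H_d$. Let $|\cdot|$ denote the Euclidean norm on $\mathbb R^d$. (i) If $L$ is a martingale (with respect to some filtration), $E\|L(t)\|^2<\infty$ for every $t\ge 0$, and $E\sqrt{|\Theta(1)|}<\infty$, then for every $t\ge0$ the random variable $X(t)$ is integrable and $E\,X(t)=0$. (ii) Let $(a,c,F)$ be the Lévy–Khintchine triplet of $\Theta$, i.e. $a\in\mathbb R^d$, $c$ is a symmetric positive semidefinite operator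 on $\mathbb R^d$, $F$ is a Borel measure on $\mathbb R^d$ with $F(\{0\})=0$ and $\int\min(1,|\theta|^2)\,F(d\theta)<\infty$, and $$E\,e^{i\langle u,\Theta(t)\rangle}=\exp\Big(t\Big(i\langle u,a\rangle-\tfrac12\langle cu,u\rangle+\int_{\mathbb R^d}\big(e^{i\langle u,\theta\rangle}-1-i\langle u,\theta\rangle 1_{\{|\theta|\le 1\}}\big)F(d\theta)\Big)\Big)$$ for all $t\ge 0$ and $u\in\mathbb R^d$. Then $$E\sqrt{|\Theta(1)|}<\infty\quad\Longleftrightarrow\quad\int_{\{|\theta|>1\}}\sqrt{|\theta|}\,F(d\theta)<\infty .$$ -/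

import Mathlib

open MeasureTheory ProbabilityTheory Filter Set
open scoped NNReal ENNReal Topology

noncomputable section

/-- A path `f : [0, ∞) → E` is càdlàg: right-continuous with left limits (at `t = 0` the
left-limit condition is void). -/
def IsCadlagPath {E : Type*} [TopologicalSpace E] (f : ℝ≥0 → E) : Prop :=
  ∀ t : ℝ≥0, ContinuousWithinAt f (Ioi t) t ∧ ∃ l : E, Tendsto f (𝓝[<] t) (𝓝 l)

/-- Lévy processes (with almost surely càdlàg paths) with values in a normed space `E`. -/
structure IsLevyProcess {Ω E : Type*} [MeasurableSpace Ω] [NormedAddCommGroup E]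
    [MeasurableSpace E] (Y : ℝ≥0 → Ω → E) (P : Measure Ω) : Prop where
  measurable : ∀ t, Measurable (Y t)
  zero : ∀ᵐ ω ∂P, Y 0 ω = 0
  indepIncrements : HasIndepIncrements Y P
  stationary : ∀ s t, IdentDistrib (fun ω => Y (s + t) ω - Y s ω) (Y t) P P
  stochContinuous : ∀ t, TendstoInMeasure P Y (𝓝 t) (Y t)
  cadlag : ∀ᵐ ω ∂P, IsCadlagPath (fun t => Y t ω)

/-- A subordinator: a real Lévy process with almost surely nondecreasing paths. -/
structure IsSubordinator {Ω : Type*} [MeasurableSpace Ω] (Y : ℝ≥0 → Ω → ℝ) (P : Measure Ω) :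
    Prop where
  levy : IsLevyProcess Y P
  monotone : ∀ᵐ ω ∂P, Monotone (fun t => Y t ω)

/-- The truncation function `χ(x) = x 1_{|x| ≤ 1}`. -/
def truncation {E : Type*} [NormedAddCommGroup E] (x : E) : E :=
  {y : E | ‖y‖ ≤ 1}.indicator id x

/-- The Lévy–Khintchine expression
`i⟨u, a⟩ - ½⟨c u, u⟩ + ∫ (exp(i⟨u, x⟩) - 1 - i⟨u, χ(x)⟩) F(dx)`. -/
def levyKhintchine {E : Type*} [NormedAddCommGroup E] [InnerProductSpace ℝ E]
    [MeasurableSpace E] (a : E) (c : E →L[ℝ] E) (F : Measure E) (u : E) : ℂ :=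
  Complex.I * ((inner ℝ u a : ℝ) : ℂ) - (1 / 2 : ℂ) * ((inner ℝ (c u) u : ℝ) : ℂ)
    + ∫ x, (Complex.exp (Complex.I * ((inner ℝ u x : ℝ) : ℂ)) - 1
        - Complex.I * ((inner ℝ u (truncation x) : ℝ) : ℂ)) ∂F

/-- `(a, c, F)` is the Lévy–Khintchine triplet of the process `Y` (with respect to the
truncation function `χ`): `c` is symmetric and positive semidefinite, `F` is a Lévy measure,
and the characteristic function of `Y t` is `exp (t * levyKhintchine a c F)`. -/
structure IsLevyTriplet {Ω E : Type*} [MeasurableSpace Ω] [NormedAddCommGroup E]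
    [InnerProductSpace ℝ E] [MeasurableSpace E] (Y : ℝ≥0 → Ω → E) (P : Measure Ω)
    (a : E) (c : E →L[ℝ] E) (F : Measure E) : Prop where
  symm : ∀ u v, inner ℝ (c u) v = inner ℝ u (c v)
  nonneg : ∀ u, 0 ≤ inner ℝ (c u) u
  zero : F {0} = 0
  lintegral_lt_top : ∫⁻ x, ENNReal.ofReal (min 1 (‖x‖ ^ 2)) ∂F < ∞
  charFun_eq : ∀ (t : ℝ≥0) (u : E),
    ∫ ω, Complex.exp (Complex.I * ((inner ℝ u (Y t ω) : ℝ) : ℂ)) ∂P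
      = Complex.exp (((t : ℝ) : ℂ) * levyKhintchine a c F u)

/-- The process `L = (L₁, …, L_d)` with values in the Hilbert direct sum of the `H j`. -/
def jointProcess {Ω : Type*} {d : ℕ} {H : Fin d → Type*} (L : ∀ j, ℝ≥0 → Ω → H j)
    (t : ℝ≥0) (ω : Ω) : PiLp 2 H :=
  WithLp.toLp 2 (fun j => L j t ω)

/-- The subordinated process `X(t) = (L₁(Θ₁(t)), …, L_d(Θ_d(t)))`. The times `Θ_j(t)` are almost
surely nonnegative for subordinators, so `Real.toNNReal` only changes `X` on a null set. -/
def subordinatedProcess {Ω : Type*} {d : ℕ} {H : Fin d → Type*} (L : ∀ j, ℝ≥0 → Ω → H j)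
    (Θ : ℝ≥0 → Ω → EuclideanSpace ℝ (Fin d)) (t : ℝ≥0) (ω : Ω) : PiLp 2 H :=
  WithLp.toLp 2 (fun j => L j (Real.toNNReal (Θ t ω j)) ω)

end

set_option linter.unusedSectionVars false

/-! Part (ii) goes through characteristic functions. The series `∑ 2ⁿ (1 - cos (x / 4ⁿ))` grows like
`√|x|` at infinity and is at most `x ^ 2`, so on a finite measure it tests half moments, while
against a Lévy measure the small jumps contribute a finite amount. For a vector `v` put `uₙ = v /
4ⁿ` and let `ψ` be the Lévy–Khintchine exponent. Under the law of `Y 1` the `n`-th cosine integral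
is `pₙ = 1 - Re exp ψ(uₙ)`; under `F` it is `ηₙ`, and `-Re ψ(uₙ) = ηₙ + ½⟨c uₙ, uₙ⟩`. The sequence
`ηₙ` is bounded, so `ηₙ ≤ const * pₙ`. Conversely `pₙ ≤ ηₙ + ½⟨c uₙ, uₙ⟩ + ½ (Im ψ(uₙ))²`, and a
finite half moment of the large jumps forces `|Im ψ(uₙ)| ≤ C / 2ⁿ`. The errors are thus `O(4⁻ⁿ)`,
summable against `2ⁿ`. This is `IsLevyTriplet.lintegral_sqrt_inner_lt_top_iff`; taking `v` in the
standard basis gives the statement for the norm.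

Part (i) works coordinatewise. A centred square-integrable Lévy process has orthogonal increments,
so `E‖L_j(s)‖ ≤ C (√s + 1)` (`IsLevyProcess.integral_norm_le`). Independence allows Fubini over the
law of `Θ_j(t)`: integrability reduces to `E√Θ_j(t) < ∞`, and the mean is an average of zeros. The
half moment passes from time `1` to time `t` by subadditivity of the square root. -/

noncomputable section

/-! ### A lacunary cosine series comparable with the square root -/

/-- The series `∑ 2ⁿ (1 - cos (x / 4ⁿ))`, which is comparable with `√|x|` for large `|x|` and
is dominated by `x ^ 2`. -/
def cosSeries (x : ℝ) : ℝ≥0∞ := ∑' n : ℕ, 2 ^ n * ENNReal.ofReal (1 - Real.cos (x / 4 ^ n))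

lemma measurable_cosSeries : Measurable cosSeries := by
  unfold cosSeries
  fun_prop

lemma cosSeries_four_mul (x : ℝ) :
    cosSeries (4 * x) = ENNReal.ofReal (1 - Real.cos (4 * x)) + 2 * cosSeries x := by
  rw [cosSeries, tsum_eq_zero_add' ENNReal.summable, cosSeries, ← ENNReal.tsum_mul_left]
  congr 1
  · simp
  · refine tsum_congr fun n => ?_
    rw [show 4 * x / 4 ^ (n + 1) = x / 4 ^ n by field_simp; ring, pow_succ]
    ring

lemma cosSeries_le_sq (x : ℝ) : cosSeries x ≤ ENNReal.ofReal (x ^ 2) := by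
  have hs : HasSum (fun n : ℕ => x ^ 2 / 2 * (1 / 8 : ℝ) ^ n) (x ^ 2 / 2 * (1 - 1 / 8)⁻¹) :=
    (hasSum_geometric_of_lt_one (by norm_num) (by norm_num)).mul_left _
  calc cosSeries x ≤ ∑' n : ℕ, ENNReal.ofReal (x ^ 2 / 2 * (1 / 8 : ℝ) ^ n) := by
        refine ENNReal.tsum_le_tsum fun n => ?_
        rw [show (2 : ℝ≥0∞) ^ n = ENNReal.ofReal (2 ^ n) by
          rw [ENNReal.ofReal_pow (by norm_num)]; simp, ← ENNReal.ofReal_mul (by positivity)]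
        refine ENNReal.ofReal_le_ofReal ?_
        have h := Real.one_sub_sq_div_two_le_cos (x := x / 4 ^ n)
        calc (2 : ℝ) ^ n * (1 - Real.cos (x / 4 ^ n)) ≤ 2 ^ n * ((x / 4 ^ n) ^ 2 / 2) := by
              gcongr; linarith
          _ = x ^ 2 / 2 * (2 / (4 ^ 2)) ^ n := by
              rw [div_pow, div_pow, ← pow_mul, ← pow_mul, mul_comm 2 n]; field_simp
          _ = _ := by norm_num
    _ = ENNReal.ofReal (x ^ 2 / 2 * (1 - 1 / 8)⁻¹) := by
        rw [← hs.tsum_eq, ENNReal.ofReal_tsum_of_nonneg (fun n => by positivity) hs.summable]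
    _ ≤ _ := ENNReal.ofReal_le_ofReal (by nlinarith [sq_nonneg x])

/-- Scaling by `4` at most doubles `cosSeries` and adds `2`. The shift by `2` absorbs that constant,
making the recursion a pure doubling, the same scaling as `√`. -/
lemma cosSeries_add_two_le (N : ℕ) :
    ∀ x : ℝ, |x| ≤ 4 ^ N → cosSeries x + 2 ≤ 3 * 2 ^ N := by
  induction N with
  | zero =>
    intro x hx
    have h : cosSeries x ≤ 1 := (cosSeries_le_sq x).trans <| by
      rw [ENNReal.ofReal_le_one, ← sq_abs]
      exact pow_le_one₀ (abs_nonneg x) (by simpa using hx)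
    calc cosSeries x + 2 ≤ 1 + 2 := by gcongr
      _ = _ := by norm_num
  | succ N ih =>
    intro x hx
    have h4 : |x / 4| ≤ 4 ^ N := by
      rw [abs_div, abs_of_pos (by norm_num : (0 : ℝ) < 4), div_le_iff₀ (by norm_num)]
      simpa [pow_succ] using hx
    have h := ih _ h4
    rw [show x = 4 * (x / 4) by ring, cosSeries_four_mul]
    have h2 : ENNReal.ofReal (1 - Real.cos (4 * (x / 4))) ≤ 2 := by
      rw [show (2 : ℝ≥0∞) = ENNReal.ofReal 2 by simp]
      exact ENNReal.ofReal_le_ofReal (by linarith [Real.neg_one_le_cos (4 * (x / 4))])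
    calc _ ≤ 2 + 2 * cosSeries (x / 4) + 2 := by gcongr
      _ = 2 * (cosSeries (x / 4) + 2) := by ring
      _ ≤ 2 * (3 * 2 ^ N) := by gcongr
      _ = _ := by ring

lemma sqrt_four_pow (N : ℕ) : √((4 : ℝ) ^ N) = 2 ^ N := by
  rw [show (4 : ℝ) ^ N = (2 ^ N) ^ 2 by rw [← pow_mul, mul_comm, pow_mul]; norm_num]
  exact Real.sqrt_sq (by positivity)

lemma cosSeries_le_sqrt (x : ℝ) : cosSeries x ≤ 6 * ENNReal.ofReal (√|x|) + 1 := by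
  rcases le_total |x| 1 with hx | hx
  · refine (cosSeries_le_sq x).trans (le_add_left ?_)
    rw [ENNReal.ofReal_le_one, ← sq_abs]
    exact pow_le_one₀ (abs_nonneg x) hx
  · obtain ⟨N, h1, h2⟩ := exists_nat_pow_near hx (by norm_num : (1 : ℝ) < 4)
    have h := cosSeries_add_two_le (N + 1) x h2.le
    have h3 : (2 : ℝ≥0∞) ^ N ≤ ENNReal.ofReal (√|x|) := by
      rw [show (2 : ℝ≥0∞) ^ N = ENNReal.ofReal (2 ^ N) by
        rw [ENNReal.ofReal_pow (by norm_num)]; simp, ← sqrt_four_pow]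
      exact ENNReal.ofReal_le_ofReal (Real.sqrt_le_sqrt h1)
    calc cosSeries x ≤ cosSeries x + 2 := le_self_add
      _ ≤ 3 * 2 ^ (N + 1) := h
      _ = 6 * 2 ^ N := by ring
      _ ≤ 6 * ENNReal.ofReal (√|x|) := by gcongr
      _ ≤ _ := le_self_add

/-- A single term suffices: for `4^N ≤ |x| < 4^(N+1)` the term `n = N + 1` has argument `y` with
`1/4 ≤ |y| ≤ 1`, whence `1 - cos y ≥ (2/π²) y² ≥ (1/8)(1/16) = 1/128`. -/
lemma sqrt_le_cosSeries (x : ℝ) : ENNReal.ofReal (√|x|) ≤ 1 + 128 * cosSeries x := by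
  rcases le_total |x| 1 with hx | hx
  · refine le_add_right ?_
    rw [ENNReal.ofReal_le_one]
    exact Real.sqrt_le_one.mpr hx
  · obtain ⟨N, h1, h2⟩ := exists_nat_pow_near hx (by norm_num : (1 : ℝ) < 4)
    refine le_add_left ?_
    have hterm : 2 ^ (N + 1) * ENNReal.ofReal (1 - Real.cos (x / 4 ^ (N + 1))) ≤ cosSeries x :=
      ENNReal.le_tsum (f := fun n : ℕ => 2 ^ n * ENNReal.ofReal (1 - Real.cos (x / 4 ^ n))) (N + 1)
    refine le_trans ?_ (mul_le_mul_right hterm 128)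
    rw [show (2 : ℝ≥0∞) ^ (N + 1) = ENNReal.ofReal (2 ^ (N + 1)) by
        rw [ENNReal.ofReal_pow (by norm_num)]; simp, ← ENNReal.ofReal_mul (by positivity),
      show (128 : ℝ≥0∞) = ENNReal.ofReal 128 by simp, ← ENNReal.ofReal_mul (by positivity)]
    refine ENNReal.ofReal_le_ofReal ?_
    set y := x / 4 ^ (N + 1) with hy
    have hyabs : |y| = |x| / 4 ^ (N + 1) := by
      rw [hy, abs_div, abs_of_pos (by positivity : (0 : ℝ) < 4 ^ (N + 1))]
    have hy1 : |y| ≤ 1 := by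
      rw [hyabs, div_le_one (by positivity)]; exact h2.le
    have hy2 : 1 / 4 ≤ |y| := by
      rw [hyabs, le_div_iff₀ (by positivity), pow_succ]; linarith
    have hcos := Real.cos_le_one_sub_mul_cos_sq (x := y) (by linarith [Real.pi_gt_three])
    have hpi : 1 / 8 ≤ 2 / Real.pi ^ 2 := by
      rw [div_le_div_iff₀ (by norm_num) (by positivity)]
      nlinarith [Real.pi_lt_four, Real.pi_pos]
    have hysq : 1 / 16 ≤ y ^ 2 := by
      rw [← sq_abs]; nlinarith
    have hc : 1 / 128 ≤ 1 - Real.cos y := by nlinarith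
    have hs : √|x| ≤ 2 ^ (N + 1) := by
      rw [← sqrt_four_pow]; exact Real.sqrt_le_sqrt h2.le
    nlinarith [pow_pos (by norm_num : (0 : ℝ) < 2) (N + 1)]

lemma lintegral_cosSeries {α : Type*} [MeasurableSpace α] (μ : Measure α) {f : α → ℝ}
    (hf : Measurable f) :
    ∫⁻ x, cosSeries (f x) ∂μ
      = ∑' n : ℕ, 2 ^ n * ∫⁻ x, ENNReal.ofReal (1 - Real.cos (f x / 4 ^ n)) ∂μ := by
  unfold cosSeries
  rw [lintegral_tsum fun n => by fun_prop]
  exact tsum_congr fun n => lintegral_const_mul _ (by fun_prop)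

/-- On a set of finite measure, `√|f|` is integrable iff `cosSeries f` is. -/
lemma lintegral_sqrt_abs_lt_top_iff {α : Type*} [MeasurableSpace α] (μ : Measure α)
    [IsFiniteMeasure μ] (f : α → ℝ) (hf : Measurable f) :
    ∫⁻ x, ENNReal.ofReal (√|f x|) ∂μ < ∞ ↔ ∫⁻ x, cosSeries (f x) ∂μ < ∞ := by
  have hm : Measurable fun x => cosSeries (f x) := measurable_cosSeries.comp hf
  constructor <;> intro h
  · refine (lintegral_mono fun x => cosSeries_le_sqrt (f x)).trans_lt ?_
    rw [lintegral_add_right _ measurable_const, lintegral_const_mul _ (by fun_prop)]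
    exact ENNReal.add_lt_top.mpr ⟨ENNReal.mul_lt_top (by simp) h, by simp⟩
  · refine (lintegral_mono fun x => sqrt_le_cosSeries (f x)).trans_lt ?_
    rw [lintegral_add_left measurable_const, lintegral_const_mul _ hm]
    exact ENNReal.add_lt_top.mpr ⟨by simp, ENNReal.mul_lt_top (by simp) h⟩

/-! ### Real and imaginary parts of the Lévy–Khintchine exponent -/

section LevyKhintchine

variable {E : Type*} [NormedAddCommGroup E] [InnerProductSpace ℝ E] [MeasurableSpace E]
  [BorelSpace E] [SecondCountableTopology E] {F : Measure E}

lemma integrable_min_one_norm_sq (hF : ∫⁻ x, ENNReal.ofReal (min 1 (‖x‖ ^ 2)) ∂F < ∞) :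
    Integrable (fun x => min 1 (‖x‖ ^ 2)) F := by
  refine ⟨by fun_prop, ?_⟩
  rw [hasFiniteIntegral_iff_ofReal (Eventually.of_forall fun x => by positivity)]
  exact hF

lemma isFiniteMeasure_restrict_one_lt_norm
    (hF : ∫⁻ x, ENNReal.ofReal (min 1 (‖x‖ ^ 2)) ∂F < ∞) :
    IsFiniteMeasure (F.restrict {x | 1 < ‖x‖}) := by
  constructor
  rw [Measure.restrict_apply_univ]
  have hS : MeasurableSet {x : E | 1 < ‖x‖} := measurableSet_lt measurable_const measurable_norm
  rw [← setLIntegral_one]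
  refine lt_of_le_of_lt ?_ hF
  refine le_trans (setLIntegral_mono' hS fun x hx => ?_) (setLIntegral_le_lintegral _ _)
  rw [ENNReal.one_le_ofReal]
  have hx : 1 < ‖x‖ := hx
  exact le_min le_rfl (by nlinarith)

/-- Small jumps are harmless because `cosSeries` is dominated by the square, and large jumps carry
finite mass. The right-hand side runs over all of `F`, so it can be read off from `Re ψ`. -/
lemma lintegral_cosSeries_inner_lt_top_iff (hF : ∫⁻ x, ENNReal.ofReal (min 1 (‖x‖ ^ 2)) ∂F < ∞)
    {v : E} (hv : ‖v‖ ≤ 1) :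
    ∫⁻ x in {x | 1 < ‖x‖}, ENNReal.ofReal (√|inner ℝ v x|) ∂F < ∞
      ↔ ∫⁻ x, cosSeries (inner ℝ v x) ∂F < ∞ := by
  have := isFiniteMeasure_restrict_one_lt_norm hF
  have hS : MeasurableSet {x : E | 1 < ‖x‖} := measurableSet_lt measurable_const measurable_norm
  rw [lintegral_sqrt_abs_lt_top_iff _ _ (by fun_prop),
    ← lintegral_add_compl (μ := F) _ hS, ENNReal.add_lt_top, iff_self_and]
  intro _
  refine lt_of_le_of_lt ?_ hF
  refine le_trans (setLIntegral_mono' hS.compl fun x hx => ?_) (setLIntegral_le_lintegral _ _)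
  refine (cosSeries_le_sq _).trans (ENNReal.ofReal_le_ofReal ?_)
  have hx : ‖x‖ ≤ 1 := not_lt.mp hx
  rw [min_eq_right (by nlinarith [norm_nonneg x]), ← sq_abs]
  have := abs_real_inner_le_norm v x
  have h2 : ‖v‖ * ‖x‖ ≤ ‖x‖ := mul_le_of_le_one_left (norm_nonneg x) hv
  gcongr
  linarith

lemma norm_exp_I_mul_sub_one_sub_le {u : E} (hu : ‖u‖ ≤ 1) {x : E} (hx : ‖x‖ ≤ 1) :
    ‖Complex.exp (Complex.I * ((inner ℝ u x : ℝ) : ℂ)) - 1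
      - Complex.I * ((inner ℝ u x : ℝ) : ℂ)‖ ≤ (inner ℝ u x) ^ 2 := by
  have h1 := abs_real_inner_le_norm u x
  have h2 : ‖Complex.I * ((inner ℝ u x : ℝ) : ℂ)‖ = |inner ℝ u x| := by simp
  have := Complex.norm_exp_sub_one_sub_id_le (x := Complex.I * ((inner ℝ u x : ℝ) : ℂ))
    (by rw [h2]; nlinarith [norm_nonneg u, norm_nonneg x])
  rwa [h2, sq_abs] at this

lemma truncation_of_norm_le {x : E} (hx : ‖x‖ ≤ 1) : truncation x = x :=
  indicator_of_mem (s := {y : E | ‖y‖ ≤ 1}) hx _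

lemma truncation_of_one_lt_norm {x : E} (hx : 1 < ‖x‖) : truncation x = 0 :=
  indicator_of_notMem (s := {y : E | ‖y‖ ≤ 1}) (not_le.mpr hx) _

lemma measurable_truncation : Measurable (truncation : E → E) :=
  measurable_id.indicator (measurableSet_le measurable_norm measurable_const)

/-- The integrand of the Lévy–Khintchine expression. -/
def levyIntegrand (u x : E) : ℂ :=
  Complex.exp (Complex.I * ((inner ℝ u x : ℝ) : ℂ)) - 1
    - Complex.I * ((inner ℝ u (truncation x) : ℝ) : ℂ)

lemma exp_I_mul_ofReal_re (y : ℝ) : (Complex.exp (Complex.I * (y : ℂ))).re = Real.cos y := by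
  rw [mul_comm, Complex.exp_ofReal_mul_I_re]

lemma exp_I_mul_ofReal_im (y : ℝ) : (Complex.exp (Complex.I * (y : ℂ))).im = Real.sin y := by
  rw [mul_comm, Complex.exp_ofReal_mul_I_im]

lemma levyIntegrand_re (u x : E) : (levyIntegrand u x).re = -(1 - Real.cos (inner ℝ u x)) := by
  simp [levyIntegrand, exp_I_mul_ofReal_re]

lemma levyIntegrand_im (u x : E) :
    (levyIntegrand u x).im = Real.sin (inner ℝ u x) - inner ℝ u (truncation x) := by
  simp [levyIntegrand, exp_I_mul_ofReal_im]

lemma norm_levyIntegrand_le {u : E} (hu : ‖u‖ ≤ 1) (x : E) :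
    ‖levyIntegrand u x‖ ≤ 2 * min 1 (‖x‖ ^ 2) := by
  rcases le_or_gt ‖x‖ 1 with hx | hx
  · rw [levyIntegrand, truncation_of_norm_le hx]
    refine (norm_exp_I_mul_sub_one_sub_le hu hx).trans ?_
    rw [min_eq_right (by nlinarith [norm_nonneg x]), ← sq_abs]
    have := abs_real_inner_le_norm u x
    have h2 : ‖u‖ * ‖x‖ ≤ ‖x‖ := mul_le_of_le_one_left (norm_nonneg x) hu
    have h3 : |inner ℝ u x| ^ 2 ≤ ‖x‖ ^ 2 := by gcongr; linarith
    nlinarith [sq_nonneg ‖x‖]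
  · rw [levyIntegrand, truncation_of_one_lt_norm hx, min_eq_left (by nlinarith)]
    simp only [inner_zero_right, Complex.ofReal_zero, mul_zero, sub_zero]
    refine (norm_sub_le _ _).trans ?_
    rw [mul_comm Complex.I, Complex.norm_exp_ofReal_mul_I, norm_one]
    norm_num

lemma measurable_levyIntegrand (u : E) : Measurable (levyIntegrand u) := by
  have := measurable_truncation (E := E)
  unfold levyIntegrand
  fun_prop

lemma integrable_levyIntegrand (hF : ∫⁻ x, ENNReal.ofReal (min 1 (‖x‖ ^ 2)) ∂F < ∞) {u : E}
    (hu : ‖u‖ ≤ 1) : Integrable (levyIntegrand u) F :=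
  ((integrable_min_one_norm_sq hF).const_mul 2).mono'
    (measurable_levyIntegrand u).aestronglyMeasurable
    (Eventually.of_forall fun x => norm_levyIntegrand_le hu x)

lemma integrable_one_sub_cos_inner (hF : ∫⁻ x, ENNReal.ofReal (min 1 (‖x‖ ^ 2)) ∂F < ∞) {u : E}
    (hu : ‖u‖ ≤ 1) : Integrable (fun x => 1 - Real.cos (inner ℝ u x)) F := by
  have h := (integrable_levyIntegrand hF hu).re.neg
  refine h.congr (Eventually.of_forall fun x => ?_)
  change -(levyIntegrand u x).re = _
  rw [levyIntegrand_re, neg_neg]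

lemma integral_one_sub_cos_inner_le (hF : ∫⁻ x, ENNReal.ofReal (min 1 (‖x‖ ^ 2)) ∂F < ∞) {u : E}
    (hu : ‖u‖ ≤ 1) :
    ∫ x, (1 - Real.cos (inner ℝ u x)) ∂F ≤ ∫ x, 2 * min 1 (‖x‖ ^ 2) ∂F := by
  refine integral_mono (integrable_one_sub_cos_inner hF hu)
    ((integrable_min_one_norm_sq hF).const_mul 2) fun x => ?_
  refine le_trans ?_ (norm_levyIntegrand_le hu x)
  have := (neg_le_abs _).trans (Complex.abs_re_le_norm (levyIntegrand u x))
  rwa [levyIntegrand_re, neg_neg] at this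

lemma levyKhintchine_re (a : E) (c : E →L[ℝ] E)
    (hF : ∫⁻ x, ENNReal.ofReal (min 1 (‖x‖ ^ 2)) ∂F < ∞) {u : E} (hu : ‖u‖ ≤ 1) :
    (levyKhintchine a c F u).re
      = -(1 / 2 * inner ℝ (c u) u) - ∫ x, (1 - Real.cos (inner ℝ u x)) ∂F := by
  have h : (∫ x, levyIntegrand u x ∂F).re = -∫ x, (1 - Real.cos (inner ℝ u x)) ∂F := by
    rw [← integral_neg]
    refine (integral_re (integrable_levyIntegrand hF hu)).symm.trans (integral_congr_ae
      (Eventually.of_forall fun x => ?_))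
    exact levyIntegrand_re u x
  change (Complex.I * ((inner ℝ u a : ℝ) : ℂ) - (1 / 2 : ℂ) * ((inner ℝ (c u) u : ℝ) : ℂ)
    + ∫ x, levyIntegrand u x ∂F).re = _
  rw [Complex.add_re, h]
  simp [sub_eq_add_neg]

lemma levyKhintchine_im (a : E) (c : E →L[ℝ] E)
    (hF : ∫⁻ x, ENNReal.ofReal (min 1 (‖x‖ ^ 2)) ∂F < ∞) {u : E} (hu : ‖u‖ ≤ 1) :
    (levyKhintchine a c F u).im
      = inner ℝ u a + ∫ x, (levyIntegrand u x).im ∂F := by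
  have h : (∫ x, levyIntegrand u x ∂F).im = ∫ x, (levyIntegrand u x).im ∂F :=
    (integral_im (integrable_levyIntegrand hF hu)).symm
  change (Complex.I * ((inner ℝ u a : ℝ) : ℂ) - (1 / 2 : ℂ) * ((inner ℝ (c u) u : ℝ) : ℂ)
    + ∫ x, levyIntegrand u x ∂F).im = _
  rw [Complex.add_im, h]
  simp

end LevyKhintchine

/-! ### Half moments of a Lévy process and of its large jumps -/

lemma one_sub_exp_re_ge {z : ℂ} {η K : ℝ} (hη : 0 ≤ η) (hK : η ≤ K) (hz : z.re ≤ -η) :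
    η ≤ (1 + K) * (1 - (Complex.exp z).re) := by
  rw [Complex.exp_re]
  have h1 : Real.exp z.re * Real.cos z.im ≤ Real.exp (-η) :=
    (mul_le_of_le_one_right (Real.exp_pos _).le (Real.cos_le_one _)).trans (Real.exp_le_exp.mpr hz)
  -- This gives `1 - exp (-η) ≥ η / (1 + η)`, and the bound `η ≤ K` makes the constant uniform.
  have h2 : Real.exp (-η) * (1 + η) ≤ 1 := by
    rw [Real.exp_neg, inv_mul_le_one₀ (Real.exp_pos _)]
    linarith [Real.add_one_le_exp η]
  have h3 : Real.exp (-η) ≤ 1 := Real.exp_le_one_iff.mpr (by linarith)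
  nlinarith

lemma one_sub_exp_re_le {z : ℂ} (hz : z.re ≤ 0) :
    1 - (Complex.exp z).re ≤ -z.re + z.im ^ 2 / 2 := by
  rw [Complex.exp_re]
  have h1 := Real.add_one_le_exp z.re
  have h2 := Real.one_sub_sq_div_two_le_cos (x := z.im)
  have h3 : Real.exp z.re ≤ 1 := Real.exp_le_one_iff.mpr hz
  have h4 := Real.exp_pos z.re
  have h5 := Real.cos_le_one z.im
  nlinarith

section Triplet

variable {Ω E : Type*} [MeasurableSpace Ω] {P : Measure Ω} [IsProbabilityMeasure P]
  [NormedAddCommGroup E] [InnerProductSpace ℝ E] [MeasurableSpace E]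
  [BorelSpace E] [SecondCountableTopology E] {F : Measure E}
  {Y : ℝ≥0 → Ω → E} {a : E} {c : E →L[ℝ] E}

lemma integrable_one_sub_cos {f : Ω → ℝ} (hf : Measurable f) :
    Integrable (fun ω => 1 - Real.cos (f ω)) P := by
  refine Integrable.of_bound (by fun_prop) 2 (Eventually.of_forall fun ω => ?_)
  rw [Real.norm_eq_abs, abs_le]
  constructor <;> linarith [Real.cos_le_one (f ω), Real.neg_one_le_cos (f ω)]

lemma IsLevyTriplet.integral_one_sub_cos (h : IsLevyTriplet Y P a c F) (hY : Measurable (Y 1))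
    (u : E) :
    ∫ ω, (1 - Real.cos (inner ℝ u (Y 1 ω))) ∂P
      = 1 - (Complex.exp (levyKhintchine a c F u)).re := by
  have hm : Measurable fun ω => inner ℝ u (Y 1 ω) := by fun_prop
  have hint : Integrable (fun ω => Complex.exp (Complex.I * ((inner ℝ u (Y 1 ω) : ℝ) : ℂ))) P := by
    refine Integrable.of_bound (by fun_prop) 1 (Eventually.of_forall fun ω => ?_)
    rw [mul_comm Complex.I, Complex.norm_exp_ofReal_mul_I]
  have hc : Integrable (fun ω => Real.cos (inner ℝ u (Y 1 ω))) P :=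
    hint.re.congr (Eventually.of_forall fun ω => exp_I_mul_ofReal_re _)
  have h1 := h.charFun_eq 1 u
  simp only [NNReal.coe_one, Complex.ofReal_one, one_mul] at h1
  rw [← h1, integral_sub (integrable_const 1) hc]
  congr 1
  · simp
  · refine Eq.trans (integral_congr_ae (Eventually.of_forall fun ω => ?_)) (integral_re hint)
    exact (exp_I_mul_ofReal_re _).symm

lemma norm_one_div_four_pow_smul_le {v : E} (hv : ‖v‖ ≤ 1) (n : ℕ) :
    ‖(1 / 4 ^ n : ℝ) • v‖ ≤ 1 := by
  rw [norm_smul, Real.norm_of_nonneg (by positivity)]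
  refine mul_le_one₀ ?_ (norm_nonneg v) hv
  rw [div_le_one (by positivity)]
  exact one_le_pow₀ (by norm_num)

/-- The rate `2⁻ⁿ` is chosen so that its square still beats the weight `2ⁿ`. For large jumps it
comes from `|sin s| ≤ √|s|`; for small jumps the quadratic bound even gives `16⁻ⁿ`. -/
lemma abs_levyIntegrand_im_smul_le {v : E} (hv : ‖v‖ ≤ 1) (n : ℕ) (x : E) :
    |(levyIntegrand ((1 / 4 ^ n : ℝ) • v) x).im| ≤
      (1 / 2 ^ n : ℝ) *
        (min 1 (‖x‖ ^ 2) + {x : E | 1 < ‖x‖}.indicator (fun x => √|inner ℝ v x|) x) := by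
  have h4 : ((1 : ℝ) / 4 ^ n) = (1 / 2 ^ n) ^ 2 := by
    rw [div_pow, ← pow_mul, mul_comm n 2, pow_mul]; norm_num
  have hpos : (0 : ℝ) < 1 / 2 ^ n := by positivity
  have hle : (1 / 2 ^ n : ℝ) ≤ 1 := by
    rw [div_le_one (by positivity)]; exact one_le_pow₀ (by norm_num)
  rcases le_or_gt ‖x‖ 1 with hx | hx
  · rw [indicator_of_notMem (by simpa using hx), add_zero,
      min_eq_right (by nlinarith [norm_nonneg x])]
    refine (Complex.abs_im_le_norm _).trans ?_
    rw [levyIntegrand, truncation_of_norm_le hx]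
    refine (norm_exp_I_mul_sub_one_sub_le (norm_one_div_four_pow_smul_le hv n) hx).trans ?_
    rw [real_inner_smul_left, mul_pow, h4]
    have h2 : (inner ℝ v x) ^ 2 ≤ ‖x‖ ^ 2 := by
      rw [← sq_abs]
      have := abs_real_inner_le_norm v x
      have h2 : ‖v‖ * ‖x‖ ≤ ‖x‖ := mul_le_of_le_one_left (norm_nonneg x) hv
      gcongr
      linarith
    have h3 : (((1 : ℝ) / 2 ^ n) ^ 2) ^ 2 ≤ 1 / 2 ^ n := by
      rw [← pow_mul]
      exact pow_le_of_le_one hpos.le hle (by norm_num)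
    gcongr
  · rw [indicator_of_mem (by simpa using hx), levyIntegrand_im, truncation_of_one_lt_norm hx,
      inner_zero_right, sub_zero, real_inner_smul_left]
    set y := inner ℝ v x
    have h1 : |Real.sin (1 / 4 ^ n * y)| ≤ √|1 / 4 ^ n * y| := by
      refine Real.le_sqrt_of_sq_le ?_
      have h2 := Real.abs_sin_le_one (1 / 4 ^ n * y)
      have h3 : |Real.sin (1 / 4 ^ n * y)| ≤ |1 / 4 ^ n * y| := Real.abs_sin_le_abs
      nlinarith [abs_nonneg (Real.sin (1 / 4 ^ n * y))]
    refine h1.trans ?_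
    rw [abs_mul, h4, abs_of_nonneg (by positivity), Real.sqrt_mul (by positivity),
      Real.sqrt_sq hpos.le]
    gcongr
    exact le_add_of_nonneg_left (by positivity)

lemma abs_levyKhintchine_im_smul_le (hF : ∫⁻ x, ENNReal.ofReal (min 1 (‖x‖ ^ 2)) ∂F < ∞)
    {v : E} (hv : ‖v‖ ≤ 1)
    (hfin : ∫⁻ x in {x | 1 < ‖x‖}, ENNReal.ofReal (√|inner ℝ v x|) ∂F < ∞) :
    ∃ C, ∀ n : ℕ, |(levyKhintchine a c F ((1 / 4 ^ n : ℝ) • v)).im| ≤ (1 / 2 ^ n : ℝ) * C := by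
  have hS : MeasurableSet {x : E | 1 < ‖x‖} := measurableSet_lt measurable_const measurable_norm
  have hint : Integrable ({x : E | 1 < ‖x‖}.indicator fun x => √|inner ℝ v x|) F := by
    rw [integrable_indicator_iff hS]
    refine ⟨by fun_prop, ?_⟩
    rwa [hasFiniteIntegral_iff_ofReal (Eventually.of_forall fun x => by positivity)]
  have hG := (integrable_min_one_norm_sq hF).add hint
  refine ⟨|inner ℝ v a| + ∫ x, (min 1 (‖x‖ ^ 2)
    + {x : E | 1 < ‖x‖}.indicator (fun x => √|inner ℝ v x|) x) ∂F, fun n => ?_⟩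
  have hu := norm_one_div_four_pow_smul_le hv n
  rw [levyKhintchine_im a c hF hu, mul_add, ← integral_const_mul]
  refine (abs_add_le _ _).trans (add_le_add ?_ ?_)
  · rw [real_inner_smul_left, abs_mul, abs_of_nonneg (by positivity)]
    gcongr
    norm_num
  · refine (abs_integral_le_integral_abs).trans ?_
    exact integral_mono (integrable_levyIntegrand hF hu).im.abs (hG.const_mul _)
      fun x => abs_levyIntegrand_im_smul_le hv n x

/-- The half moment of a linear functional of a Lévy process is finite iff it is finite for the
large jumps. -/
lemma IsLevyTriplet.lintegral_sqrt_inner_lt_top_iff (h : IsLevyTriplet Y P a c F)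
    (hY : Measurable (Y 1)) {v : E} (hv : ‖v‖ ≤ 1) :
    ∫⁻ ω, ENNReal.ofReal (√|inner ℝ v (Y 1 ω)|) ∂P < ∞ ↔
      ∫⁻ x in {x | 1 < ‖x‖}, ENNReal.ofReal (√|inner ℝ v x|) ∂F < ∞ := by
  have hF := h.lintegral_lt_top
  have hm : Measurable fun ω => inner ℝ v (Y 1 ω) := by fun_prop
  have hnn : ∀ y : ℝ, 0 ≤ 1 - Real.cos y := fun y => by linarith [Real.cos_le_one y]
  set u : ℕ → E := fun n => (1 / 4 ^ n : ℝ) • v with hu_def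
  have hu : ∀ n, ‖u n‖ ≤ 1 := norm_one_div_four_pow_smul_le hv
  set p : ℕ → ℝ := fun n => ∫ ω, (1 - Real.cos (inner ℝ (u n) (Y 1 ω))) ∂P
  set η : ℕ → ℝ := fun n => ∫ x, (1 - Real.cos (inner ℝ (u n) x)) ∂F
  have hη : ∀ n, 0 ≤ η n := fun n => integral_nonneg fun x => hnn _
  have hpψ : ∀ n, p n = 1 - (Complex.exp (levyKhintchine a c F (u n))).re :=
    fun n => h.integral_one_sub_cos hY (u n)
  have hre : ∀ n, (levyKhintchine a c F (u n)).re
      = -(1 / 2 * inner ℝ (c (u n)) (u n)) - η n := fun n => levyKhintchine_re a c hF (hu n)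
  have hdiv : ∀ (n : ℕ) (x : E), inner ℝ v x / 4 ^ n = inner ℝ (u n) x := fun n x => by
    rw [hu_def, real_inner_smul_left]; ring
  have hSY : ∫⁻ ω, cosSeries (inner ℝ v (Y 1 ω)) ∂P
      = ∑' n : ℕ, 2 ^ n * ENNReal.ofReal (p n) := by
    rw [lintegral_cosSeries P hm]
    refine tsum_congr fun n => ?_
    simp_rw [hdiv]
    rw [ofReal_integral_eq_lintegral_ofReal (integrable_one_sub_cos (by fun_prop))
      (Eventually.of_forall fun ω => hnn _)]
  have hSF : ∫⁻ x, cosSeries (inner ℝ v x) ∂F = ∑' n : ℕ, 2 ^ n * ENNReal.ofReal (η n) := by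
    rw [lintegral_cosSeries F (by fun_prop)]
    refine tsum_congr fun n => ?_
    simp_rw [hdiv]
    rw [ofReal_integral_eq_lintegral_ofReal (integrable_one_sub_cos_inner hF (hu n))
      (Eventually.of_forall fun ω => hnn _)]
  rw [lintegral_sqrt_abs_lt_top_iff P _ hm, hSY]
  constructor
  · intro hp
    rw [lintegral_cosSeries_inner_lt_top_iff hF hv, hSF]
    -- A bound for all `η n` at once, so that one constant compares the two series.
    set K := ∫ x, 2 * min 1 (‖x‖ ^ 2) ∂F
    have hK : 0 ≤ K := integral_nonneg fun x => by positivity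
    have hle : ∀ n, η n ≤ (1 + K) * p n := fun n => by
      rw [hpψ]
      refine one_sub_exp_re_ge (hη n) (integral_one_sub_cos_inner_le hF (hu n)) ?_
      rw [hre]
      linarith [h.nonneg (u n)]
    calc ∑' n : ℕ, 2 ^ n * ENNReal.ofReal (η n)
        ≤ ∑' n : ℕ, ENNReal.ofReal (1 + K) * (2 ^ n * ENNReal.ofReal (p n)) := by
          refine ENNReal.tsum_le_tsum fun n => ?_
          rw [mul_left_comm, ← ENNReal.ofReal_mul (by positivity)]
          gcongr
          exact hle n
      _ < ∞ := by
          rw [ENNReal.tsum_mul_left]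
          exact ENNReal.mul_lt_top ENNReal.ofReal_lt_top hp
  · intro hfin
    -- The half moment of the large jumps is used twice: here to control `Im ψ`, and below for the
    -- summability of `2ⁿ ηₙ`.
    obtain ⟨C, hC⟩ := abs_levyKhintchine_im_smul_le (a := a) (c := c) hF hv hfin
    rw [lintegral_cosSeries_inner_lt_top_iff hF hv, hSF] at hfin
    -- `D` collects the Gaussian term and the squared imaginary part, both bounded by multiples of
    -- `4⁻ⁿ`.
    set D := inner ℝ (c v) v / 2 + C ^ 2 / 2 with hD_def
    have hD : 0 ≤ D := by have := h.nonneg v; positivity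
    have hle : ∀ n, p n ≤ η n + (1 / 4) ^ n * D := fun n => by
      have hc0 : inner ℝ (c (u n)) (u n) ≤ (1 / 4 : ℝ) ^ n * inner ℝ (c v) v := by
        rw [hu_def, map_smul, real_inner_smul_left, real_inner_smul_right, ← mul_assoc, one_div_pow]
        refine mul_le_mul_of_nonneg_right (mul_le_of_le_one_left (by positivity) ?_) (h.nonneg v)
        rw [div_le_one (by positivity)]
        exact one_le_pow₀ (by norm_num)
      have him : (levyKhintchine a c F (u n)).im ^ 2 ≤ (1 / 4 : ℝ) ^ n * C ^ 2 := by
        rw [← sq_abs, show (1 / 4 : ℝ) ^ n * C ^ 2 = (1 / 2 ^ n * C) ^ 2 by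
          rw [mul_pow, ← one_div_pow, ← pow_mul, mul_comm n 2, pow_mul]; norm_num]
        exact pow_le_pow_left₀ (abs_nonneg _) (hC n) 2
      rw [hpψ]
      refine (one_sub_exp_re_le ?_).trans ?_
      · rw [hre]; linarith [h.nonneg (u n), hη n]
      · rw [hre, hD_def]; linarith
    calc ∑' n : ℕ, 2 ^ n * ENNReal.ofReal (p n)
        ≤ ∑' n : ℕ, (2 ^ n * ENNReal.ofReal (η n) + ENNReal.ofReal ((1 / 2) ^ n * D)) := by
          refine ENNReal.tsum_le_tsum fun n => ?_
          have h2 : ENNReal.ofReal ((1 / 2) ^ n * D) = 2 ^ n * ENNReal.ofReal ((1 / 4) ^ n * D) := by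
            rw [show (2 : ℝ≥0∞) ^ n = ENNReal.ofReal (2 ^ n) by
              rw [ENNReal.ofReal_pow (by norm_num)]; simp, ← ENNReal.ofReal_mul (by positivity),
              ← mul_assoc, ← mul_pow]
            norm_num
          rw [h2, ← mul_add, ← ENNReal.ofReal_add (hη n) (by positivity)]
          gcongr
          exact hle n
      _ < ∞ := by
          rw [ENNReal.tsum_add]
          refine ENNReal.add_lt_top.mpr ⟨hfin, ?_⟩
          rw [← ENNReal.ofReal_tsum_of_nonneg (fun n => by positivity)
            ((summable_geometric_of_lt_one (by norm_num) (by norm_num)).mul_right D)]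
          exact ENNReal.ofReal_lt_top

end Triplet

/-! ### Reduction of the norm to coordinates -/

lemma EuclideanSpace.sqrt_norm_le_sum {d : ℕ} (x : EuclideanSpace ℝ (Fin d)) :
    √‖x‖ ≤ ∑ j, √|x j| := by
  rw [Real.sqrt_le_left (Finset.sum_nonneg fun j _ => Real.sqrt_nonneg _)]
  calc ‖x‖ = ‖∑ j, x j • EuclideanSpace.basisFun (Fin d) ℝ j‖ := by
        congr 1
        exact ((EuclideanSpace.basisFun (Fin d) ℝ).sum_repr x).symm
    _ ≤ ∑ j, |x j| := (norm_sum_le _ _).trans_eq (by simp [norm_smul])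
    _ = ∑ j, √|x j| ^ 2 := by simp
    _ ≤ (∑ j, √|x j|) ^ 2 := Finset.sum_sq_le_sq_sum_of_nonneg fun j _ => Real.sqrt_nonneg _

lemma EuclideanSpace.lintegral_sqrt_norm_lt_top_iff {d : ℕ} {α : Type*} [MeasurableSpace α]
    (μ : Measure α) (f : α → EuclideanSpace ℝ (Fin d)) (hf : Measurable f) :
    ∫⁻ x, ENNReal.ofReal (√‖f x‖) ∂μ < ∞ ↔
      ∀ j, ∫⁻ x, ENNReal.ofReal (√|f x j|) ∂μ < ∞ := by
  constructor
  · intro h j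
    refine lt_of_le_of_lt (lintegral_mono fun x => ENNReal.ofReal_le_ofReal ?_) h
    exact Real.sqrt_le_sqrt (PiLp.norm_apply_le (f x) j)
  · intro h
    refine lt_of_le_of_lt
      (lintegral_mono fun x => ENNReal.ofReal_le_ofReal (sqrt_norm_le_sum (f x))) ?_
    simp_rw [ENNReal.ofReal_sum_of_nonneg fun j _ => Real.sqrt_nonneg _]
    rw [lintegral_finsetSum _ fun j _ => by fun_prop]
    exact ENNReal.sum_lt_top.mpr fun j _ => h j

/-- The square root of the norm of a Lévy process at time `1` is integrable iff it is integrable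
for the large jumps. -/
theorem IsLevyTriplet.integrable_sqrt_norm_iff {Ω : Type*} [MeasurableSpace Ω] {P : Measure Ω}
    [IsProbabilityMeasure P] {d : ℕ} {Y : ℝ≥0 → Ω → EuclideanSpace ℝ (Fin d)}
    {a : EuclideanSpace ℝ (Fin d)} {c : EuclideanSpace ℝ (Fin d) →L[ℝ] EuclideanSpace ℝ (Fin d)}
    {F : Measure (EuclideanSpace ℝ (Fin d))} (h : IsLevyTriplet Y P a c F)
    (hY : Measurable (Y 1)) :
    Integrable (fun ω => √‖Y 1 ω‖) P ↔
      ∫⁻ θ in {θ | 1 < ‖θ‖}, ENNReal.ofReal (√‖θ‖) ∂F < ∞ := by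
  have hI : Integrable (fun ω => √‖Y 1 ω‖) P ↔ ∫⁻ ω, ENNReal.ofReal (√‖Y 1 ω‖) ∂P < ∞ := by
    rw [← hasFiniteIntegral_iff_ofReal (Eventually.of_forall fun ω => Real.sqrt_nonneg _)]
    exact and_iff_right (by fun_prop)
  rw [hI, EuclideanSpace.lintegral_sqrt_norm_lt_top_iff P _ hY,
    EuclideanSpace.lintegral_sqrt_norm_lt_top_iff _ (fun θ => θ) measurable_id]
  refine forall_congr' fun j => ?_
  have := h.lintegral_sqrt_inner_lt_top_iff hY (v := EuclideanSpace.basisFun (Fin d) ℝ j) (by simp)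
  simpa [EuclideanSpace.inner_single_left] using this

/-! ### Evaluation of a process at an independent random time -/

/-- Evaluation of a path at a time, as a limit along times `(k + 1) / (n + 1)` from the right.
It is jointly measurable, and it is the usual evaluation for right-continuous paths. -/
def rightEval {E : Type*} [TopologicalSpace E] [Nonempty E] (p : ℝ≥0 × (ℝ≥0 → E)) : E :=
  limUnder atTop fun n : ℕ => p.2 ((⌊(n + 1 : ℝ≥0) * p.1⌋₊ + 1) / (n + 1))

/-- For fixed `n` only countably many times occur, so the approximant factors through `ℕ × (ℝ≥0 →
E)`, where evaluation is measurable on each slice. -/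
lemma stronglyMeasurable_rightEval {E : Type*} [NormedAddCommGroup E] [CompleteSpace E]
    [SecondCountableTopology E] [MeasurableSpace E] [BorelSpace E] :
    StronglyMeasurable (rightEval (E := E)) := by
  refine StronglyMeasurable.limUnder fun n => Measurable.stronglyMeasurable ?_
  have h1 : Measurable fun q : ℕ × (ℝ≥0 → E) => q.2 ((q.1 + 1) / (n + 1)) :=
    measurable_from_prod_countable_right fun k => by
      change Measurable fun ℓ : ℝ≥0 → E => ℓ ((k + 1) / (n + 1))
      exact measurable_pi_apply _
  have h2 : Measurable fun p : ℝ≥0 × (ℝ≥0 → E) => (⌊(n + 1 : ℝ≥0) * p.1⌋₊, p.2) :=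
    ((measurable_fst.const_mul _).nat_floor).prodMk measurable_snd
  exact h1.comp h2

/-- The `+ 1` in the numerator puts the times strictly to the right of `t`, where right-continuity
applies. -/
lemma tendsto_floor_mul_add_one_div (t : ℝ≥0) :
    Tendsto (fun n : ℕ => ((⌊(n + 1 : ℝ≥0) * t⌋₊ + 1) / (n + 1) : ℝ≥0)) atTop (𝓝[>] t) := by
  refine tendsto_nhdsWithin_iff.mpr ⟨?_, Eventually.of_forall fun n => ?_⟩
  · have hlim : Tendsto (fun n : ℕ => t + 1 / ((n : ℝ≥0) + 1)) atTop (𝓝 (t + 0)) :=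
      tendsto_const_nhds.add tendsto_one_div_add_atTop_nhds_zero_nat
    rw [add_zero] at hlim
    refine tendsto_of_tendsto_of_tendsto_of_le_of_le tendsto_const_nhds hlim (fun n => ?_)
      fun n => ?_
    · change t ≤ _
      rw [le_div_iff₀ (by positivity), mul_comm]
      exact (Nat.lt_floor_add_one _).le
    · change _ ≤ t + 1 / ((n : ℝ≥0) + 1)
      rw [add_div]
      gcongr
      rw [div_le_iff₀ (by positivity), mul_comm t]
      exact Nat.floor_le (by positivity)
  · rw [mem_Ioi, lt_div_iff₀ (by positivity), mul_comm]
    exact Nat.lt_floor_add_one _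

lemma IsCadlagPath.rightEval_eq {E : Type*} [TopologicalSpace E] [T2Space E] [Nonempty E]
    {f : ℝ≥0 → E} (hf : IsCadlagPath f) (t : ℝ≥0) : rightEval (t, f) = f t :=
  Tendsto.limUnder_eq ((hf t).1.tendsto.comp (tendsto_floor_mul_add_one_div t))

/-- A centred process with almost surely càdlàg paths, evaluated at an independent random time, is
integrable and centred if its first moments are integrable against the law of the time. -/
lemma integrable_and_integral_eq_zero_of_indepFun {Ω E : Type*} [MeasurableSpace Ω]
    {P : Measure Ω} [IsProbabilityMeasure P] [NormedAddCommGroup E] [NormedSpace ℝ E]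
    [CompleteSpace E] [SecondCountableTopology E] [MeasurableSpace E] [BorelSpace E]
    {Y : ℝ≥0 → Ω → E} {T : Ω → ℝ≥0} (hY : ∀ t, Measurable (Y t)) (hT : Measurable T)
    (hcad : ∀ᵐ ω ∂P, IsCadlagPath fun t => Y t ω)
    (hind : IndepFun T (fun ω t => Y t ω) P) (hYint : ∀ t, Integrable (Y t) P)
    (hzero : ∀ t, ∫ ω, Y t ω ∂P = 0) {b : ℝ≥0 → ℝ} (hb : Measurable b)
    (hYb : ∀ t, ∫ ω, ‖Y t ω‖ ∂P ≤ b t) (hbT : Integrable (fun ω => b (T ω)) P) :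
    Integrable (fun ω => Y (T ω) ω) P ∧ ∫ ω, Y (T ω) ω ∂P = 0 := by
  have hpath : Measurable fun ω t => Y t ω := measurable_pi_lambda _ hY
  set ν := P.map fun ω t => Y t ω with hν
  have : IsProbabilityMeasure ν := Measure.isProbabilityMeasure_map hpath.aemeasurable
  have : IsProbabilityMeasure (P.map T) := Measure.isProbabilityMeasure_map hT.aemeasurable
  -- Independence of the time from the whole path makes the joint law a product, so Fubini can
  -- freeze the time.
  have hmap : P.map (fun ω => (T ω, fun t => Y t ω)) = (P.map T).prod ν :=
    hind.map_prod_eq_prod_map_map hT.aemeasurable hpath.aemeasurable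
  have hM := stronglyMeasurable_rightEval (E := E)
  have hpair : Measurable fun ω => (T ω, fun t => Y t ω) := hT.prodMk hpath
  have heq : (fun ω => rightEval (T ω, fun t => Y t ω)) =ᵐ[P] fun ω => Y (T ω) ω := by
    filter_upwards [hcad] with ω hω using hω.rightEval_eq (T ω)
  have hsec : ∀ s, (fun ω => rightEval (s, fun t => Y t ω)) =ᵐ[P] Y s := fun s => by
    filter_upwards [hcad] with ω hω using hω.rightEval_eq s
  have hMs : ∀ s, StronglyMeasurable fun ℓ : ℝ≥0 → E => rightEval (s, ℓ) := fun s =>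
    hM.comp_measurable measurable_prodMk_left
  have hint : Integrable rightEval ((P.map T).prod ν) := by
    rw [integrable_prod_iff hM.aestronglyMeasurable]
    constructor
    · refine Eventually.of_forall fun s => ?_
      rw [hν, integrable_map_measure (hMs s).aestronglyMeasurable hpath.aemeasurable]
      exact (hYint s).congr (hsec s).symm
    · have hbint : Integrable b (P.map T) :=
        (integrable_map_measure hb.aestronglyMeasurable hT.aemeasurable).mpr hbT
      refine hbint.mono' hM.norm.integral_prod_right'.aestronglyMeasurable
        (Eventually.of_forall fun s => ?_)
      rw [Real.norm_of_nonneg (integral_nonneg fun _ => norm_nonneg _), hν,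
        integral_map hpath.aemeasurable (hMs s).norm.aestronglyMeasurable]
      refine le_trans (le_of_eq (integral_congr_ae ?_)) (hYb s)
      filter_upwards [hsec s] with ω hω
      rw [hω]
  have hintT : Integrable (fun ω => rightEval (T ω, fun t => Y t ω)) P := by
    rw [← hmap, integrable_map_measure hM.aestronglyMeasurable hpair.aemeasurable] at hint
    exact hint
  refine ⟨hintT.congr heq, ?_⟩
  rw [← integral_congr_ae heq,
    ← integral_map (f := rightEval) hpair.aemeasurable hM.aestronglyMeasurable, hmap,
    integral_prod _ hint]
  refine (integral_congr_ae (Eventually.of_forall fun s => ?_)).trans (integral_zero _ _)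
  change ∫ ℓ, rightEval (s, ℓ) ∂ν = 0
  rw [hν, integral_map hpath.aemeasurable (hMs s).aestronglyMeasurable, integral_congr_ae (hsec s),
    hzero]

/-! ### Moment growth of centred Lévy processes -/

lemma integral_norm_add_sq_of_indepFun {Ω E : Type*} [MeasurableSpace Ω]
    {P : Measure Ω} [IsProbabilityMeasure P] [NormedAddCommGroup E] [InnerProductSpace ℝ E]
    [CompleteSpace E] [MeasurableSpace E] [BorelSpace E] {X Y : Ω → E}
    (hX : MemLp X 2 P) (hY : MemLp Y 2 P) (hind : IndepFun X Y P) (h0 : ∫ ω, Y ω ∂P = 0) :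
    ∫ ω, ‖X ω + Y ω‖ ^ 2 ∂P = ∫ ω, ‖X ω‖ ^ 2 ∂P + ∫ ω, ‖Y ω‖ ^ 2 ∂P := by
  have hX1 := hX.integrable (by norm_num)
  have hY1 := hY.integrable (by norm_num)
  have hXY : Integrable (fun ω => inner ℝ (X ω) (Y ω)) P :=
    hind.integrable_bilin hX1 hY1 (innerSL ℝ)
  -- By independence the mean of the inner product is the inner product of the means, and one of
  -- these is zero.
  have h := hind.integral_bilin hX1 hY1 (innerSL ℝ)
  have hzero : ∫ ω, inner ℝ (X ω) (Y ω) ∂P = 0 := by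
    refine Eq.trans h ?_
    rw [h0, map_zero]
  have hX2 := hX.integrable_norm_pow (by norm_num)
  have hY2 := hY.integrable_norm_pow (by norm_num)
  have hXXY : Integrable (fun ω => ‖X ω‖ ^ 2 + 2 * inner ℝ (X ω) (Y ω)) P :=
    hX2.add (hXY.const_mul 2)
  simp_rw [norm_add_sq_real]
  rw [integral_add hXXY hY2, integral_add hX2 (hXY.const_mul 2),
    integral_const_mul, hzero]
  ring

section CentredLevy

variable {Ω E : Type*} [MeasurableSpace Ω] {P : Measure Ω} [IsProbabilityMeasure P]
  [NormedAddCommGroup E] [InnerProductSpace ℝ E] [CompleteSpace E]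
  [MeasurableSpace E] [BorelSpace E] {Y : ℝ≥0 → Ω → E}

lemma IsLevyProcess.integral_norm_sq_add (hY : IsLevyProcess Y P) (h2 : ∀ t, MemLp (Y t) 2 P)
    (h0 : ∀ t, ∫ ω, Y t ω ∂P = 0) (s t : ℝ≥0) :
    ∫ ω, ‖Y (s + t) ω‖ ^ 2 ∂P = ∫ ω, ‖Y s ω‖ ^ 2 ∂P + ∫ ω, ‖Y t ω‖ ^ 2 ∂P := by
  have hind : IndepFun (Y s) (fun ω => Y (s + t) ω - Y s ω) P :=
    hY.indepIncrements.indepFun_eval_sub (zero_le) le_self_add hY.zero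
  have hst := hY.stationary s t
  have h := integral_norm_add_sq_of_indepFun (h2 s) ((h2 (s + t)).sub (h2 s)) hind
    (hst.integral_eq.trans (h0 t))
  simp only [Pi.sub_apply, add_sub_cancel] at h
  rw [h]
  congr 1
  exact (hst.comp (measurable_norm.pow_const 2)).integral_eq

/-- Second moments are additive in time, hence linear on the integers; since they are also
nonnegative, rounding `t` up to `⌈t⌉₊ ≤ t + 1` only increases them. -/
lemma IsLevyProcess.integral_norm_sq_le (hY : IsLevyProcess Y P) (h2 : ∀ t, MemLp (Y t) 2 P)
    (h0 : ∀ t, ∫ ω, Y t ω ∂P = 0) (t : ℝ≥0) :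
    ∫ ω, ‖Y t ω‖ ^ 2 ∂P ≤ (t + 1) * ∫ ω, ‖Y 1 ω‖ ^ 2 ∂P := by
  have hnn : ∀ s, 0 ≤ ∫ ω, ‖Y s ω‖ ^ 2 ∂P := fun s => integral_nonneg fun ω => by positivity
  have hadd := hY.integral_norm_sq_add h2 h0
  have hnat : ∀ n : ℕ, ∫ ω, ‖Y n ω‖ ^ 2 ∂P = n * ∫ ω, ‖Y 1 ω‖ ^ 2 ∂P := by
    intro n
    induction n with
    | zero =>
      -- Additivity at `0 + 0` makes the second moment at time `0` equal to its double, hence zero.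
      have := hadd 0 0
      rw [add_zero] at this
      simp only [Nat.cast_zero, zero_mul]
      linarith
    | succ n ih => rw [Nat.cast_succ, hadd, ih]; push_cast; ring
  obtain ⟨r, hr⟩ := exists_add_of_le (Nat.le_ceil t)
  have h1 := hadd t r
  rw [← hr, hnat] at h1
  have h3 : (⌈t⌉₊ : ℝ) ≤ t + 1 := by exact_mod_cast (Nat.ceil_lt_add_one zero_le).le
  nlinarith [hnn r, hnn 1]

lemma IsLevyProcess.integral_norm_le (hY : IsLevyProcess Y P) (h2 : ∀ t, MemLp (Y t) 2 P)
    (h0 : ∀ t, ∫ ω, Y t ω ∂P = 0) (t : ℝ≥0) :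
    ∫ ω, ‖Y t ω‖ ∂P ≤ √(∫ ω, ‖Y 1 ω‖ ^ 2 ∂P) * (√t + 1) := by
  have hnn : 0 ≤ ∫ ω, ‖Y 1 ω‖ ^ 2 ∂P := integral_nonneg fun ω => by positivity
  -- Nonnegative variance of `‖Y t‖` is the Cauchy–Schwarz bound `(E‖Y t‖)² ≤ E‖Y t‖²`.
  have hvar := variance_nonneg (fun ω => ‖Y t ω‖) P
  rw [variance_eq_sub (h2 t).norm] at hvar
  have hsq : (∫ ω, ‖Y t ω‖ ∂P) ^ 2 ≤ (t + 1) * ∫ ω, ‖Y 1 ω‖ ^ 2 ∂P := by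
    refine le_trans ?_ (hY.integral_norm_sq_le h2 h0 t)
    simpa using hvar
  refine (Real.le_sqrt_of_sq_le hsq).trans ?_
  rw [Real.sqrt_mul (by positivity), mul_comm]
  gcongr
  rw [Real.sqrt_le_left (by positivity)]
  nlinarith [Real.sq_sqrt t.coe_nonneg, Real.sqrt_nonneg (t : ℝ)]

end CentredLevy

/-! ### Half moments of a subordinator -/

lemma Real.sqrt_le_sqrt_add_sqrt_sub {x y : ℝ} (hxy : x ≤ y) : √y ≤ √x + √(y - x) := by
  rcases le_total 0 x with hx | hx
  · rw [Real.sqrt_le_left (by positivity)]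
    nlinarith [Real.sq_sqrt hx, Real.sq_sqrt (sub_nonneg.mpr hxy), Real.sqrt_nonneg x,
      Real.sqrt_nonneg (y - x), mul_nonneg (Real.sqrt_nonneg x) (Real.sqrt_nonneg (y - x))]
  · rw [Real.sqrt_eq_zero_of_nonpos hx, zero_add]
    exact Real.sqrt_le_sqrt (by linarith)

/-- The half moments of a subordinator are finite if the one at time `1` is. -/
lemma IsSubordinator.integrable_sqrt {Ω : Type*} [MeasurableSpace Ω] {P : Measure Ω}
    [IsProbabilityMeasure P] {Y : ℝ≥0 → Ω → ℝ} (hY : IsSubordinator Y P)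
    (h1 : Integrable (fun ω => √(Y 1 ω)) P) (t : ℝ≥0) : Integrable (fun ω => √(Y t ω)) P := by
  have hm := hY.levy.measurable
  have hnat : ∀ n : ℕ, Integrable (fun ω => √(Y n ω)) P := by
    intro n
    induction n with
    | zero =>
      refine (integrable_zero Ω ℝ P).congr ?_
      filter_upwards [hY.levy.zero] with ω hω
      simp [hω]
    | succ n ih =>
      -- The unit increment has the law of `Y 1`, so subadditivity of the square root carries the
      -- induction.
      have hinc : Integrable (fun ω => √(Y (n + 1) ω - Y n ω)) P :=
        ((hY.levy.stationary n 1).comp (measurable_id.sqrt)).integrable_iff.mpr h1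
      refine (ih.add hinc).mono' (by fun_prop) ?_
      filter_upwards [hY.monotone] with ω hω
      rw [Real.norm_of_nonneg (Real.sqrt_nonneg _), Nat.cast_succ]
      exact Real.sqrt_le_sqrt_add_sqrt_sub (hω le_self_add)
  -- Monotone paths bound time `t` by the next integer time.
  refine (hnat ⌈t⌉₊).mono' (by fun_prop) ?_
  filter_upwards [hY.monotone] with ω hω
  rw [Real.norm_of_nonneg (Real.sqrt_nonneg _)]
  exact Real.sqrt_le_sqrt (hω (Nat.le_ceil t))

lemma Real.sqrt_coe_toNNReal (x : ℝ) : √(x.toNNReal : ℝ) = √x := by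
  rcases le_total 0 x with hx | hx
  · rw [Real.coe_toNNReal x hx]
  · rw [Real.toNNReal_of_nonpos hx, NNReal.coe_zero, Real.sqrt_zero,
      Real.sqrt_eq_zero_of_nonpos hx]

end

/-! ### Proof of the theorem -/

theorem theorem3p7 {Ω : Type*} [mΩ : MeasurableSpace Ω] (P : Measure Ω) [IsProbabilityMeasure P]
    (d : ℕ) (H : Fin d → Type*) [∀ j, NormedAddCommGroup (H j)]
    [∀ j, InnerProductSpace ℝ (H j)] [∀ j, CompleteSpace (H j)]
    [∀ j, TopologicalSpace.SeparableSpace (H j)]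
    [∀ j, MeasurableSpace (H j)] [∀ j, BorelSpace (H j)]
    (L : ∀ j, ℝ≥0 → Ω → H j) (Θ : ℝ≥0 → Ω → EuclideanSpace ℝ (Fin d))
    (hL : ∀ j, IsLevyProcess (L j) P)
    (hLindep : iIndepFun (fun (j : Fin d) (ω : Ω) (t : ℝ≥0) => L j t ω) P)
    (hΘ : IsLevyProcess Θ P)
    (hΘsub : ∀ j, IsSubordinator (fun t ω => Θ t ω j) P)
    (hLΘ : IndepFun (fun (ω : Ω) (j : Fin d) (t : ℝ≥0) => L j t ω)
      (fun (ω : Ω) (t : ℝ≥0) => Θ t ω) P) :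
    ((∃ ℱ : Filtration ℝ≥0 mΩ, Martingale (jointProcess L) ℱ P) →
      (∀ t, MemLp (jointProcess L t) 2 P) →
      Integrable (fun ω => √‖Θ 1 ω‖) P →
        ∀ t, Integrable (subordinatedProcess L Θ t) P ∧
          ∫ ω, subordinatedProcess L Θ t ω ∂P = 0) ∧
    (∀ (a : EuclideanSpace ℝ (Fin d))
      (c : EuclideanSpace ℝ (Fin d) →L[ℝ] EuclideanSpace ℝ (Fin d))
      (F : Measure (EuclideanSpace ℝ (Fin d))), IsLevyTriplet Θ P a c F →
        (Integrable (fun ω => √‖Θ 1 ω‖) P ↔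
          ∫⁻ θ in {θ | 1 < ‖θ‖}, ENNReal.ofReal (√‖θ‖) ∂F < ∞)) := by
  refine ⟨?_, fun a c F h => h.integrable_sqrt_norm_iff (hΘ.measurable 1)⟩
  rintro ⟨ℱ, hmart⟩ hL2 hΘ1 t
  have := fun j => UniformSpace.secondCountable_of_separable (H j)
  -- A martingale has constant mean, and here it starts at `0`.
  have hjoint : ∀ s, ∫ ω, jointProcess L s ω ∂P = 0 := fun s => by
    have h := hmart.setIntegral_eq (zero_le (a := s)) (s := univ) MeasurableSet.univ
    rw [setIntegral_univ, setIntegral_univ] at h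
    rw [← h]
    refine (integral_congr_ae ?_).trans (integral_zero _ _)
    filter_upwards [ae_all_iff.mpr fun j => (hL j).zero] with ω hω
    ext j
    exact hω j
  have hmem : ∀ j s, MemLp (L j s) 2 P := fun j s =>
    (hL2 s).mono ((hL j).measurable s).aestronglyMeasurable
      (Eventually.of_forall fun ω => PiLp.norm_apply_le (jointProcess L s ω) j)
  have hzero : ∀ j s, ∫ ω, L j s ω ∂P = 0 := fun j s => by
    have h := (PiLp.proj (𝕜 := ℝ) 2 H j).integral_comp_comm (hmart.integrable s)
    rw [hjoint s, map_zero] at h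
    exact h
  have hcoord : ∀ j, Integrable (fun ω => L j (Θ t ω j).toNNReal ω) P ∧
      ∫ ω, L j (Θ t ω j).toNNReal ω ∂P = 0 := fun j => by
    have hΘm := (hΘsub j).levy.measurable
    have hroot : Integrable (fun ω => √(Θ t ω j)) P := by
      refine (hΘsub j).integrable_sqrt (hΘ1.mono' (hΘm 1).sqrt.aestronglyMeasurable
        (Eventually.of_forall fun ω => ?_)) t
      rw [Real.norm_of_nonneg (Real.sqrt_nonneg _)]
      exact Real.sqrt_le_sqrt ((le_abs_self _).trans (PiLp.norm_apply_le (Θ 1 ω) j))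
    have hind : IndepFun (fun ω => (Θ t ω j).toNNReal) (fun ω s => L j s ω) P :=
      (hLΘ.comp (φ := fun x : ∀ i, ℝ≥0 → H i => x j)
        (ψ := fun y : ℝ≥0 → EuclideanSpace ℝ (Fin d) => (y t j).toNNReal)
        (measurable_pi_apply j) (by fun_prop)).symm
    refine integrable_and_integral_eq_zero_of_indepFun (hL j).measurable (hΘm t).real_toNNReal
      (hL j).cadlag hind (fun s => (hmem j s).integrable (by norm_num)) (hzero j)
      -- This `b` is the square-root growth bound on the first moments; composed with the random
      -- time it needs only the half moment `hroot`.
      (b := fun s => √(∫ ω, ‖L j 1 ω‖ ^ 2 ∂P) * (√s + 1)) (by fun_prop)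
      ((hL j).integral_norm_le (hmem j) (hzero j)) ?_
    simp_rw [Real.sqrt_coe_toNNReal]
    exact (hroot.add (integrable_const 1)).const_mul _
  have hint : Integrable (subordinatedProcess L Θ t) P :=
    Integrable.of_eval_piLp fun j => (hcoord j).1
  refine ⟨hint, ?_⟩
  ext j
  have h := (PiLp.proj (𝕜 := ℝ) 2 H j).integral_comp_comm hint
  exact h.symm.trans (hcoord j).2
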